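/- Let $(X,\mu)$ be a $\sigma$-finite measure space and let $T:X\to X$ be an invertible (i.e. bijective, with $T$ and $T^{-1}$ measurable) measure-preserving transformation. A Rokhlin column for $T$ is a finite collection of pairwise disjoint measurable sets $B, TB,\dots,T^{h-1}B$, $h\ge 1$, called its levels. $T$ is called rank-one if there is a sequence of Rokhlin columns $C_n$ such that for every measurable $A\subset X$ with $\mu(A)<\infty$ and every $\varepsilon>0$ there is an $N$ such that for all $n\ge N$ some union $B'_n$ of levels of $C_n$ satisfies $\mu(A\,\triangle\, B'_n)<\varepsilon$. An invertible transformation $S$ of $X$ is nonsingular if for every measurable $A$ one has $\mu(A)=0$ if and only if $\mu(S(A))=0$; the centralizer $C(T)$ is the set of all invertible nonsingular $S$ with $ST=TS$ almost everywhere; and $T$ is squashable if $C(T)$ contains some $S$ that is not measure-preserving. **Corollary.** If $T$ is rank-one, then every $S\in C(T)$ is measure-preserving. Thus $T$ is not squashable. -/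

import Mathlib

open MeasureTheory
open scoped ENNReal symmDiff

/-- A Rokhlin column for the invertible measurable transformation `T`: pairwise disjoint
measurable sets `B, T B, …, T ^ (h - 1) B`, with `h ≥ 1`. -/
structure RokhlinColumn {X : Type*} [MeasurableSpace X] (T : X ≃ᵐ X) where
  /-- the bottom level `B` -/
  base : Set X
  /-- the number of levels `h` -/
  height : ℕ
  height_pos : 0 < height
  measurableSet_base : MeasurableSet base
  disjoint_levels : ∀ i < height, ∀ j < height, i ≠ j →
    Disjoint ((⇑T)^[i] '' base) ((⇑T)^[j] '' base)

/-- The `i`-th level `T ^ i B` of a column; only the indices `i < C.height` are levels. -/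
def RokhlinColumn.level {X : Type*} [MeasurableSpace X] {T : X ≃ᵐ X} (C : RokhlinColumn T)
    (i : ℕ) : Set X :=
  (⇑T)^[i] '' C.base

/-- `B'` is a union of levels of the column `C`. -/
def RokhlinColumn.IsUnionOfLevels {X : Type*} [MeasurableSpace X] {T : X ≃ᵐ X}
    (C : RokhlinColumn T) (B' : Set X) : Prop :=
  ∃ s : Finset ℕ, (∀ i ∈ s, i < C.height) ∧ B' = ⋃ i ∈ s, C.level i

/-- A rank-one transformation: an invertible measure-preserving transformation with a sequence of
Rokhlin columns approximating every measurable set of finite measure by unions of levels. -/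
structure IsRankOne {X : Type*} [MeasurableSpace X] (μ : Measure X) (T : X ≃ᵐ X) : Prop where
  measurePreserving : MeasurePreserving (⇑T) μ μ
  exists_columns : ∃ C : ℕ → RokhlinColumn T,
    ∀ A : Set X, MeasurableSet A → μ A < ∞ → ∀ ε : ℝ≥0∞, 0 < ε →
      ∃ N : ℕ, ∀ n ≥ N, ∃ B' : Set X, (C n).IsUnionOfLevels B' ∧ μ (A ∆ B') < ε

/-- The invertible transformation `S` is nonsingular: a measurable set is null if and only if its
image under `S` is null. -/
def IsNonsingular {X : Type*} [MeasurableSpace X] (μ : Measure X) (S : X ≃ᵐ X) : Prop :=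
  ∀ A : Set X, MeasurableSet A → (μ A = 0 ↔ μ (⇑S '' A) = 0)

/-- The nonsingular centralizer `C(T)`: all invertible nonsingular `S` with `S T = T S`, as usual
up to a null set. -/
def nonsingularCentralizer {X : Type*} [MeasurableSpace X] (μ : Measure X) (T : X ≃ᵐ X) :
    Set (X ≃ᵐ X) :=
  {S | IsNonsingular μ S ∧ ∀ᵐ x ∂μ, S (T x) = T (S x)}

/-- `T` is squashable if its nonsingular centralizer contains a transformation that does not
preserve the measure. -/
def IsSquashable {X : Type*} [MeasurableSpace X] (μ : Measure X) (T : X ≃ᵐ X) : Prop :=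
  ∃ S ∈ nonsingularCentralizer μ T, ¬ MeasurePreserving (⇑S) μ μ

namespace RokhlinColumn

variable {X : Type*} [MeasurableSpace X] {T : X ≃ᵐ X} (C : RokhlinColumn T)

/-! Rank one forces ergodicity, so the `T`-invariant measure `μ.map S.symm ≪ μ` equals `c • μ`. It
remains to exclude `c ≠ 1`. Let `R` commute with `T` and scale `μ` by `c`, and approximate `A` and
`R ⁻¹' A` by unions `U`, `V` of levels of one column. Within one level of `V`, the preimages of the
levels of `U` have total measure at most that of the `R`-preimage of the base, which is `c` times
the measure of a level. Hence `c * μ A ≈ μ (R ⁻¹' U ∩ V) ≤ c * μ V ≈ c * (c * μ A)`, so `1 ≤ c`.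
Applied to `S.symm` and `S`, this gives `c = 1`. -/

lemma measurableSet_level (i : ℕ) : MeasurableSet (C.level i) := by
  have h : MeasurableEmbedding (⇑T)^[i] := by
    induction i with
    | zero => exact MeasurableEmbedding.id
    | succ k ih => exact ih.comp T.measurableEmbedding
  exact h.measurableSet_image.2 C.measurableSet_base

lemma preimage_iterate_level (i : ℕ) : (⇑T)^[i] ⁻¹' C.level i = C.base :=
  Set.preimage_image_eq _ (T.injective.iterate i)

lemma pairwiseDisjoint_level {s : Finset ℕ} (hs : ∀ i ∈ s, i < C.height) :
    (s : Set ℕ).PairwiseDisjoint C.level :=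
  fun i hi j hj hij ↦ C.disjoint_levels i (hs i hi) j (hs j hj) hij

/-- The times below the height at which a point visits a given level are unique. -/
lemma disjoint_preimage_iterate_level {i i' : ℕ} (hi : i < C.height) (hi' : i' < C.height)
    (hne : i ≠ i') (j : ℕ) :
    Disjoint ((⇑T)^[i] ⁻¹' C.level j) ((⇑T)^[i'] ⁻¹' C.level j) := by
  wlog hlt : i < i' generalizing i i'
  · exact (this hi' hi hne.symm (by omega)).symm
  rw [Set.disjoint_left]
  rintro x ⟨y, hy, hyx⟩ ⟨z, hz, hzx⟩
  -- Two visits would make the base meet level `i' - i`, and `0 < i' - i < C.height`.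
  have h : (⇑T)^[i' - i] y = z := by
    apply T.injective.iterate j
    rw [hzx, ← Function.iterate_add_apply, Nat.add_comm, Function.iterate_add_apply, hyx,
      ← Function.iterate_add_apply, Nat.sub_add_cancel hlt.le]
  refine Set.disjoint_left.1 (C.disjoint_levels (i' - i) (by omega) 0 C.height_pos (by omega))
    ⟨y, hy, h⟩ ⟨z, hz, rfl⟩

variable {μ : Measure X}

lemma measure_level_inter (hT : MeasurePreserving T μ μ) {A : Set X} (hA : MeasurableSet A)
    (hTA : T ⁻¹' A = A) (i : ℕ) : μ (C.level i ∩ A) = μ (C.base ∩ A) := by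
  rw [← (hT.iterate i).measure_preimage ((C.measurableSet_level i).inter hA).nullMeasurableSet,
    Set.preimage_inter, C.preimage_iterate_level, Set.preimage_iterate_eq]
  congr 2
  exact Function.iterate_fixed hTA i

lemma measure_biUnion_level_inter (hT : MeasurePreserving T μ μ) {A : Set X}
    (hA : MeasurableSet A) (hTA : T ⁻¹' A = A) {s : Finset ℕ} (hs : ∀ i ∈ s, i < C.height) :
    μ ((⋃ i ∈ s, C.level i) ∩ A) = s.card * μ (C.base ∩ A) := by
  rw [Set.iUnion₂_inter, measure_biUnion_finset
    ((C.pairwiseDisjoint_level hs).mono fun i ↦ Set.inter_subset_left)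
    fun i _ ↦ (C.measurableSet_level i).inter hA]
  simp [C.measure_level_inter hT hA hTA]

lemma measure_biUnion_level (hT : MeasurePreserving T μ μ) {s : Finset ℕ}
    (hs : ∀ i ∈ s, i < C.height) : μ (⋃ i ∈ s, C.level i) = s.card * μ C.base := by
  simpa using C.measure_biUnion_level_inter hT MeasurableSet.univ rfl hs

/-- If `R` commutes with `T`, the part of the `R`-preimage of a union of levels that lies in the
union of the levels indexed by `t` is at most `t.card` times the `R`-preimage of the base. -/
lemma measure_preimage_biUnion_level_inter_le (hT : MeasurePreserving T μ μ) {R : X → X}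
    (hR : Measurable R) (hRT : ∀ᵐ x ∂μ, R (T x) = T (R x)) {s t : Finset ℕ}
    (hs : ∀ i ∈ s, i < C.height) :
    μ (R ⁻¹' (⋃ i ∈ s, C.level i) ∩ ⋃ j ∈ t, C.level j) ≤ t.card * μ (R ⁻¹' C.base) := by
  have hcomm (i : ℕ) : ∀ᵐ x ∂μ, R ((⇑T)^[i] x) = (⇑T)^[i] (R x) := by
    induction i with
    | zero => simp
    | succ k ih =>
      filter_upwards [ih, (hT.iterate k).quasiMeasurePreserving.ae hRT] with x h₁ h₂
      rw [Function.iterate_succ_apply', h₂, h₁, Function.iterate_succ_apply']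
  have hpart (i j : ℕ) : μ (R ⁻¹' C.level i ∩ C.level j) =
      μ (R ⁻¹' C.base ∩ (⇑T)^[i] ⁻¹' C.level j) := by
    rw [← (hT.iterate i).measure_preimage
      ((hR (C.measurableSet_level i)).inter (C.measurableSet_level j)).nullMeasurableSet]
    refine measure_congr (Filter.eventuallyEq_set.2 ?_)
    filter_upwards [hcomm i] with x hx
    rw [← C.preimage_iterate_level i]
    simp [hx]
  -- Pulled back by `T^i`, the pieces become disjoint subsets of the single set `R ⁻¹' C.base`.
  have hunion (j : ℕ) : ∑ i ∈ s, μ (R ⁻¹' C.level i ∩ C.level j) ≤ μ (R ⁻¹' C.base) := by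
    simp_rw [hpart]
    rw [← measure_biUnion_finset (fun i hi i' hi' hne ↦
      (C.disjoint_preimage_iterate_level (hs i hi) (hs i' hi') hne j).mono
        Set.inter_subset_right Set.inter_subset_right)
      fun i _ ↦ (hR C.measurableSet_base).inter
        ((hT.iterate i).measurable (C.measurableSet_level j))]
    exact measure_mono (Set.iUnion₂_subset fun i _ ↦ Set.inter_subset_left)
  calc μ (R ⁻¹' (⋃ i ∈ s, C.level i) ∩ ⋃ j ∈ t, C.level j)
      = μ (⋃ j ∈ t, ⋃ i ∈ s, R ⁻¹' C.level i ∩ C.level j) := by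
        simp only [Set.preimage_iUnion, Set.inter_iUnion, Set.iUnion_inter]
    _ ≤ ∑ j ∈ t, μ (⋃ i ∈ s, R ⁻¹' C.level i ∩ C.level j) := measure_biUnion_finset_le _ _
    _ ≤ ∑ j ∈ t, ∑ i ∈ s, μ (R ⁻¹' C.level i ∩ C.level j) :=
        Finset.sum_le_sum fun j _ ↦ measure_biUnion_finset_le _ _
    _ ≤ ∑ j ∈ t, μ (R ⁻¹' C.base) := Finset.sum_le_sum fun j _ ↦ hunion j
    _ = t.card * μ (R ⁻¹' C.base) := by simp

end RokhlinColumn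

section RankOne

variable {X : Type*} [MeasurableSpace X] {μ : Measure X} {T : X ≃ᵐ X}

/-- Since the approximation holds for all large `n`, one column serves both sets; the later
estimates need this common base. -/
lemma IsRankOne.exists_column (hT : IsRankOne μ T) {A A' : Set X} (hA : MeasurableSet A)
    (hA' : MeasurableSet A') (hμA : μ A < ∞) (hμA' : μ A' < ∞) {ε : ℝ≥0∞} (hε : 0 < ε) :
    ∃ C : RokhlinColumn T, ∃ s t : Finset ℕ, (∀ i ∈ s, i < C.height) ∧ (∀ i ∈ t, i < C.height) ∧
      μ (A ∆ ⋃ i ∈ s, C.level i) < ε ∧ μ (A' ∆ ⋃ i ∈ t, C.level i) < ε := by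
  obtain ⟨C, hC⟩ := hT.exists_columns
  obtain ⟨N, hN⟩ := hC A hA hμA ε hε
  obtain ⟨N', hN'⟩ := hC A' hA' hμA' ε hε
  obtain ⟨_, ⟨s, hs, rfl⟩, hsε⟩ := hN (max N N') (le_max_left _ _)
  obtain ⟨_, ⟨t, ht, rfl⟩, htε⟩ := hN' (max N N') (le_max_right _ _)
  exact ⟨C (max N N'), s, t, hs, ht, hsε, htε⟩

lemma measure_le_add_measure_symmDiff (μ : Measure X) (A B : Set X) :
    μ A ≤ μ B + μ (A ∆ B) := by
  refine (measure_mono fun x hx ↦ ?_).trans (measure_union_le _ _)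
  by_cases h : x ∈ B
  · exact Or.inl h
  · exact Or.inr (Or.inl ⟨hx, h⟩)

/-- A rank-one transformation is ergodic. -/
lemma IsRankOne.ergodic [SigmaFinite μ] (hT : IsRankOne μ T) : Ergodic T μ := by
  refine ⟨hT.measurePreserving, ⟨fun A hA hTA ↦ ?_⟩⟩
  rw [Filter.eventuallyConst_set']
  by_contra! hcon
  have hA0 : 0 < μ A := pos_iff_ne_zero.2 fun h ↦ hcon.1 (ae_eq_empty.2 h)
  have hAc0 : 0 < μ Aᶜ := pos_iff_ne_zero.2 fun h ↦ hcon.2 (ae_eq_univ.2 h)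
  obtain ⟨E, hE, hEA, hE0, hEtop⟩ := Measure.exists_subset_measure_lt_top hA hA0
  obtain ⟨F, hF, hFA, hF0, hFtop⟩ := Measure.exists_subset_measure_lt_top hA.compl hAc0
  set ε := min (μ E) (μ F) / 2 with hε
  have hmin0 : min (μ E) (μ F) ≠ 0 := (lt_min hE0 hF0).ne'
  have hmintop : min (μ E) (μ F) ≠ ∞ := ((min_le_left _ _).trans_lt hEtop).ne
  have hε0 : 0 < ε := ENNReal.half_pos hmin0
  have hεtop : ε ≠ ∞ := (ENNReal.half_lt_self hmin0 hmintop).ne_top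
  obtain ⟨C, s, t, hs, ht, hsε, htε⟩ := hT.exists_column hE hF hEtop hFtop hε0
  have hTAc : T ⁻¹' Aᶜ = Aᶜ := by rw [Set.preimage_compl, hTA]
  have key {G A : Set X} (hA : MeasurableSet A) (hTA : T ⁻¹' A = A) (hGA : G ⊆ A)
      (hGε : ε + ε ≤ μ G) {s : Finset ℕ} (hs : ∀ i ∈ s, i < C.height)
      (hsε : μ (G ∆ ⋃ i ∈ s, C.level i) < ε) :
      ε < s.card * μ (C.base ∩ A) ∧ s.card * μ (C.base ∩ Aᶜ) < ε := by
    rw [← C.measure_biUnion_level_inter hT.measurePreserving hA hTA hs,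
      ← C.measure_biUnion_level_inter hT.measurePreserving hA.compl
        (by rw [Set.preimage_compl, hTA]) hs]
    constructor
    · by_contra! hle
      refine (hGε.trans (?_ : μ G ≤ _)).not_gt (ENNReal.add_lt_add_of_le_of_lt
        (hle.trans_lt hεtop.lt_top).ne hle hsε)
      refine (measure_mono fun x hx ↦ ?_).trans (measure_union_le _ _)
      by_cases h : x ∈ ⋃ i ∈ s, C.level i
      · exact Or.inl ⟨h, hGA hx⟩
      · exact Or.inr (Or.inl ⟨hx, h⟩)
    · exact (measure_mono fun x hx ↦ Or.inr ⟨hx.1, fun h ↦ hx.2 (hGA h)⟩).trans_lt hsε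
  have hεε : ε + ε = min (μ E) (μ F) := ENNReal.add_halves _
  obtain ⟨h₁, h₂⟩ := key hA hTA hEA (hεε.le.trans (min_le_left _ _)) hs hsε
  obtain ⟨h₃, h₄⟩ := key hA.compl hTAc hFA (hεε.le.trans (min_le_right _ _)) ht htε
  rw [compl_compl] at h₄
  -- All levels split between `A` and `Aᶜ` in the same proportion, so they cannot favour `A` for `s`
  -- and `Aᶜ` for `t`: the two products agree.
  have h₅ : ε * ε < (s.card * μ (C.base ∩ A)) * (t.card * μ (C.base ∩ Aᶜ)) :=
    ENNReal.mul_lt_mul h₁ h₃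
  have h₆ : (s.card * μ (C.base ∩ Aᶜ)) * (t.card * μ (C.base ∩ A)) < ε * ε :=
    ENNReal.mul_lt_mul h₂ h₄
  refine (h₅.trans_eq ?_).not_gt h₆
  ring

/-- A map that commutes with a rank-one transformation and scales the measure does not shrink
it. -/
lemma IsRankOne.one_le_of_map_eq_smul [SigmaFinite μ] [NeZero μ] (hT : IsRankOne μ T)
    {R : X → X} (hR : Measurable R) (hRT : ∀ᵐ x ∂μ, R (T x) = T (R x)) {c : ℝ≥0∞} (hc0 : c ≠ 0)
    (hc : c ≠ ∞) (hmap : μ.map R = c • μ) : 1 ≤ c := by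
  obtain ⟨A, hA, -, hA0, hAtop⟩ := Measure.exists_subset_measure_lt_top (μ := μ) (r := 0)
    MeasurableSet.univ (pos_iff_ne_zero.2 (Measure.measure_univ_ne_zero.2 (NeZero.ne μ)))
  have hpre {B : Set X} (hB : MeasurableSet B) : μ (R ⁻¹' B) = c * μ B := by
    rw [← Measure.map_apply hR hB, hmap, Measure.smul_apply, smul_eq_mul]
  have hRAtop : μ (R ⁻¹' A) < ∞ := by
    rw [hpre hA]
    exact ENNReal.mul_lt_top hc.lt_top hAtop
  -- The error is `c * ε` from `A` to `U`, `c * ε + ε` for the part of `R ⁻¹' U` outside `V`, and `c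
  -- * ε` from `V` to `R ⁻¹' A`.
  have key (ε : ℝ≥0∞) (hε : 0 < ε) : c * μ A ≤ c * (c * μ A) + (3 * c + 1) * ε := by
    obtain ⟨C, s, t, hs, ht, hsε, htε⟩ := hT.exists_column hA (hR hA) hAtop hRAtop hε
    have hle := C.measure_preimage_biUnion_level_inter_le hT.measurePreserving hR hRT (t := t) hs
    rw [hpre C.measurableSet_base, mul_left_comm,
      ← C.measure_biUnion_level hT.measurePreserving ht] at hle
    have hU : MeasurableSet (⋃ i ∈ s, C.level i) :=
      Finset.measurableSet_biUnion _ fun i _ ↦ C.measurableSet_level i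
    set U := ⋃ i ∈ s, C.level i
    set V := ⋃ i ∈ t, C.level i
    have hAU : μ A ≤ μ U + ε := (measure_le_add_measure_symmDiff μ A U).trans (by gcongr)
    have hVA : μ V ≤ c * μ A + ε := by
      rw [← hpre hA]
      refine (measure_le_add_measure_symmDiff μ V (R ⁻¹' A)).trans ?_
      rw [symmDiff_comm]
      gcongr
    have hUV : c * μ U ≤ c * μ V + (c * ε + ε) := by
      calc c * μ U = μ (R ⁻¹' U) := (hpre hU).symm
        _ ≤ μ ((R ⁻¹' U ∩ V) ∪ (R ⁻¹' (A ∆ U) ∪ (R ⁻¹' A) ∆ V)) := by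
            refine measure_mono fun x hx ↦ ?_
            by_cases hV : x ∈ V
            · exact Or.inl ⟨hx, hV⟩
            by_cases hxA : x ∈ R ⁻¹' A
            · exact Or.inr (Or.inr (Or.inl ⟨hxA, hV⟩))
            · exact Or.inr (Or.inl (Or.inr ⟨hx, hxA⟩))
        _ ≤ μ (R ⁻¹' U ∩ V) + (μ (R ⁻¹' (A ∆ U)) + μ ((R ⁻¹' A) ∆ V)) :=
            (measure_union_le _ _).trans (by gcongr; exact measure_union_le _ _)
        _ ≤ c * μ V + (c * ε + ε) := by
            rw [hpre (hA.symmDiff hU)]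
            gcongr
    calc c * μ A ≤ c * (μ U + ε) := by gcongr
      _ = c * μ U + c * ε := mul_add _ _ _
      _ ≤ c * μ V + (c * ε + ε) + c * ε := by gcongr
      _ ≤ c * (c * μ A + ε) + (c * ε + ε) + c * ε := by gcongr
      _ = c * (c * μ A) + (3 * c + 1) * ε := by ring
  have hK0 : 3 * c + 1 ≠ 0 := by simp
  have hKtop : 3 * c + 1 ≠ ∞ := by finiteness
  have hle : c * μ A ≤ c * (c * μ A) := by
    refine ENNReal.le_of_forall_pos_le_add fun δ hδ _ ↦ ?_
    have h := key (δ / (3 * c + 1)) (ENNReal.div_pos (by exact_mod_cast hδ.ne') hKtop)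
    rwa [ENNReal.mul_div_cancel hK0 hKtop] at h
  refine (ENNReal.mul_le_mul_iff_left (mul_ne_zero hc0 hA0.ne')
    (ENNReal.mul_ne_top hc hAtop.ne)).1 ?_
  rwa [one_mul]

/-- An invariant σ-finite measure that is absolutely continuous with respect to an ergodic
σ-finite measure is a multiple of it. -/
lemma Ergodic.exists_eq_smul_of_absolutelyContinuous [SigmaFinite μ] {ν : Measure X}
    [SigmaFinite ν] (hT : Ergodic T μ) (hν : MeasurePreserving T ν ν) (hνμ : ν ≪ μ) :
    ∃ c : ℝ≥0∞, ν = c • μ := by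
  have hf : Measurable (ν.rnDeriv μ) := Measure.measurable_rnDeriv ν μ
  have hd : μ.withDensity (ν.rnDeriv μ) = ν := Measure.withDensity_rnDeriv_eq ν μ hνμ
  -- By invariance of both measures, the density composed with `T` is again a density of `ν`.
  -- Uniqueness makes it `T`-invariant, and ergodicity constant.
  have hinv : μ.withDensity (ν.rnDeriv μ ∘ T) = μ.withDensity (ν.rnDeriv μ) := by
    ext A hA
    have hA' : T ⁻¹' (T '' A) = A := Set.preimage_image_eq _ T.injective
    have hTA : MeasurableSet (T '' A) := T.measurableEmbedding.measurableSet_image.2 hA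
    rw [withDensity_apply _ hA]
    conv_lhs => rw [← hA']
    rw [show (∫⁻ a in T ⁻¹' (T '' A), (ν.rnDeriv μ ∘ T) a ∂μ) = _ from
      hT.toMeasurePreserving.setLIntegral_comp_preimage hTA hf,
      ← withDensity_apply _ hTA, hd, ← hν.measure_preimage hTA.nullMeasurableSet, hA']
  obtain ⟨c, hc⟩ := hT.ae_eq_const_of_ae_eq_comp₀ hf.nullMeasurable
    ((withDensity_eq_iff_of_sigmaFinite (hf.comp T.measurable).aemeasurable hf.aemeasurable).1 hinv)
  refine ⟨c, ?_⟩
  rw [← hd, withDensity_congr_ae hc]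
  exact withDensity_const c

lemma IsNonsingular.quasiMeasurePreserving {S : X ≃ᵐ X} (hS : IsNonsingular μ S) :
    Measure.QuasiMeasurePreserving S μ μ := by
  refine ⟨S.measurable, Measure.AbsolutelyContinuous.mk fun A hA hA0 ↦ ?_⟩
  rwa [S.map_apply, hS _ (S.measurable hA), Set.image_preimage_eq _ S.surjective]

lemma IsNonsingular.quasiMeasurePreserving_symm {S : X ≃ᵐ X} (hS : IsNonsingular μ S) :
    Measure.QuasiMeasurePreserving S.symm μ μ := by
  refine ⟨S.symm.measurable, Measure.AbsolutelyContinuous.mk fun A hA hA0 ↦ ?_⟩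
  rwa [S.symm.map_apply, ← S.image_eq_preimage_symm, ← hS A hA]

/-- Nonsingular transformations commuting with a rank-one transformation preserve the measure. -/
lemma IsRankOne.measurePreserving_of_mem_nonsingularCentralizer [SigmaFinite μ]
    (hT : IsRankOne μ T) {S : X ≃ᵐ X} (hS : S ∈ nonsingularCentralizer μ T) :
    MeasurePreserving S μ μ := by
  obtain ⟨hS, hST⟩ := hS
  rcases eq_or_ne μ 0 with rfl | hμ
  · exact ⟨S.measurable, by simp⟩
  have : NeZero μ := ⟨hμ⟩
  have hST' : ∀ᵐ x ∂μ, S.symm (T x) = T (S.symm x) := by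
    filter_upwards [hS.quasiMeasurePreserving_symm.ae hST] with x hx
    rw [S.symm_apply_eq, hx, S.apply_symm_apply]
  have hinv : MeasurePreserving T (μ.map S.symm) (μ.map S.symm) := by
    refine ⟨T.measurable, ?_⟩
    rw [Measure.map_map T.measurable S.symm.measurable,
      Measure.map_congr (f := T ∘ S.symm) (g := S.symm ∘ T) (hST'.mono fun x hx ↦ hx.symm),
      ← Measure.map_map S.symm.measurable T.measurable, hT.measurePreserving.map_eq]
  have : SigmaFinite (μ.map S.symm) := S.symm.sigmaFinite_map
  obtain ⟨c, hc⟩ := hT.ergodic.exists_eq_smul_of_absolutelyContinuous hinv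
    hS.quasiMeasurePreserving_symm.absolutelyContinuous
  have hc' : μ = c • μ.map S := by
    rw [← Measure.map_smul, ← hc, Measure.map_map S.measurable S.symm.measurable]
    simp
  have hc0 : c ≠ 0 := by
    rintro rfl
    exact hμ (by simpa using hc')
  -- A measure `∞ • μ` takes only the values `0` and `∞`, so it cannot be nonzero and σ-finite.
  have hctop : c ≠ ∞ := by
    rintro rfl
    obtain ⟨A, hA, -, hA0, hAtop⟩ := Measure.exists_subset_measure_lt_top (μ := μ.map S.symm)
      (r := 0) MeasurableSet.univ (by
        rw [S.symm.map_apply]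
        exact pos_iff_ne_zero.2 (Measure.measure_univ_ne_zero.2 hμ))
    rw [hc, Measure.smul_apply, smul_eq_mul] at hA0 hAtop
    rcases eq_or_ne (μ A) 0 with h | h
    · simp [h] at hA0
    · simp [ENNReal.top_mul h] at hAtop
  have hmap : μ.map S = c⁻¹ • μ := by
    nth_rw 2 [hc']
    rw [smul_smul, ENNReal.inv_mul_cancel hc0 hctop, one_smul]
  have h₁ : 1 ≤ c := hT.one_le_of_map_eq_smul S.symm.measurable hST' hc0 hctop hc
  have h₂ : 1 ≤ c⁻¹ := hT.one_le_of_map_eq_smul S.measurable hST (ENNReal.inv_ne_zero.2 hctop)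
    (ENNReal.inv_ne_top.2 hc0) hmap
  have h₃ : c = 1 := le_antisymm (ENNReal.one_le_inv.1 h₂) h₁
  exact ⟨S.measurable, by rw [hmap, h₃, inv_one, one_smul]⟩

end RankOne

theorem corollaryC {X : Type*} [MeasurableSpace X] (μ : Measure X) [SigmaFinite μ]
    (T : X ≃ᵐ X) (hT : IsRankOne μ T) :
    (∀ S ∈ nonsingularCentralizer μ T, MeasurePreserving (⇑S) μ μ) ∧ ¬ IsSquashable μ T :=
  ⟨fun _ hS ↦ hT.measurePreserving_of_mem_nonsingularCentralizer hS,
    fun ⟨_, hS, hn⟩ ↦ hn (hT.measurePreserving_of_mem_nonsingularCentralizer hS)⟩
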